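/- Let $P$ be a finite nonempty bipartite graph without isolated vertices, with vertex set $A\sqcup B$ and every edge joining a vertex of $A$ to a vertex of $B$. Regard $P$ also as a poset (pure of rank $2$) on its vertices, with $a<b$ if and only if $a\in A$, $b\in B$ and $\{a,b\}$ is an edge. Let $\Bbbk$ be a field and let $\mathcal F(P)\subseteq \Bbbk[x_p : p\in P]$ be the flag ideal of $P$, generated by the monomials $\prod_{p\in C}x_p$ with $C$ a maximal chain of $P$; it is the edge ideal of the graph, generated by all $x_ax_b$ with $\{a,b\}$ an edge. The following are equivalent. (a) $\mathcal F(P)$ has a linear resolution, i.e. there is an integer $t\ge 0$ such that, for the standard grading of $R=\Bbbk[x_p : p\in P]$, the $i$-th module of the minimal graded free resolution of $\mathcal F(P)$ is a direct sum of copies of $R(-t-i)$, for every $i\ge 0$. (b) $P$ has no induced subgraph consisting of two disjoint edges. (c) $P$ is a Ferrers graph: its vertices can be labelled, without repetition, as $x_1,\dots,x_n,y_1,\dots,y_m$ with $n,m\ge 1$, such that every edge joins some $x_i$ to some $y_j$; whenever $\{x_p,y_q\}$ is an edge, so is $\{x_i,y_j\}$ for all $i\le p$ and $j\le q$; and $\{x_1,y_m\}$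 and $\{x_n,y_1\}$ are edges. -/

import Mathlib

namespace FlagIdeals

open MvPolynomial

section Resolutions

variable {σ K : Type*} [Field K]

/-- A graded free resolution `⋯ → F 1 → F 0 → I → 0` of an ideal `I` of the standard graded
polynomial ring `R = K[x_σ]`, with every `F i` of finite rank. The module `F i` is free on a finite
set `ι i` whose element `k` sits in degree `deg i k`, that is `F i = ⨁ k, R(-deg i k)`, and all the
maps are homogeneous of degree zero. -/
structure GradedFreeResolution (I : Ideal (MvPolynomial σ K)) where
  /-- the homogeneous basis of the `i`-th module -/
  ι : ℕ → Type
  finite_ι : ∀ i, Finite (ι i)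
  /-- the degrees of the basis elements -/
  deg : ∀ i, ι i → ℕ
  /-- the augmentation, whose image is `I` -/
  aug : (ι 0 →₀ MvPolynomial σ K) →ₗ[MvPolynomial σ K] MvPolynomial σ K
  /-- the differential from the module in position `i + 1` to the one in position `i` -/
  d : ∀ i, (ι (i + 1) →₀ MvPolynomial σ K) →ₗ[MvPolynomial σ K] (ι i →₀ MvPolynomial σ K)
  aug_homogeneous : ∀ k, (aug (Finsupp.single k 1)).IsHomogeneous (deg 0 k)
  d_homogeneous : ∀ i k j, d i (Finsupp.single k 1) j = 0 ∨
    ∃ n, deg (i + 1) k = deg i j + n ∧ (d i (Finsupp.single k 1) j).IsHomogeneous n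
  range_aug : LinearMap.range aug = I
  exact_zero : Function.Exact (d 0) aug
  exact_succ : ∀ i, Function.Exact (d (i + 1)) (d i)

/-- The resolution is minimal: every differential maps into the graded maximal ideal times its
target, i.e. no matrix entry has a constant term. -/
def GradedFreeResolution.IsMinimal {I : Ideal (MvPolynomial σ K)}
    (F : GradedFreeResolution I) : Prop :=
  ∀ i k j, constantCoeff (F.d i (Finsupp.single k 1) j) = 0

/-- `I` has a linear resolution: for some `t`, the `i`-th module of the minimal graded free
resolution of `I` is a direct sum of copies of `R(-t-i)`. -/
def HasLinearResolution (I : Ideal (MvPolynomial σ K)) : Prop :=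
  ∃ (t : ℕ) (F : GradedFreeResolution I), F.IsMinimal ∧ ∀ i k, F.deg i k = t + i

end Resolutions

/-- The ideal of maximal flags of a poset `P`: it is generated by the squarefree monomials
`∏ p ∈ s, x_p`, for `s` a (finite) maximal chain of `P`. -/
noncomputable def flagIdeal (K P : Type*) [Field K] [PartialOrder P] :
    Ideal (MvPolynomial P K) :=
  Ideal.span {f | ∃ s : Finset P, IsMaxChain (· ≤ ·) (s : Set P) ∧ f = ∏ p ∈ s, X p}

section Graphs

variable {V : Type*} {G : SimpleGraph V} {A B : Set V}

/-- A bipartite graph with parts `A` and `B`, seen as a poset on its vertices: `a < b` if and only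
if `a ∈ A`, `b ∈ B` and `{a, b}` is an edge. -/
abbrev bipartitePoset (h : G.IsBipartiteWith A B) : PartialOrder V where
  le a b := a = b ∨ (a ∈ A ∧ b ∈ B ∧ G.Adj a b)
  le_refl _ := Or.inl rfl
  le_trans a b c := by
    rintro (rfl | ⟨ha, hb, hab⟩) (rfl | ⟨hb', hc, hbc⟩)
    · exact Or.inl rfl
    · exact Or.inr ⟨hb', hc, hbc⟩
    · exact Or.inr ⟨ha, hb, hab⟩
    · exact (Set.disjoint_left.mp h.disjoint hb' hb).elim
  le_antisymm a b := by
    rintro (rfl | ⟨ha, hb, hab⟩) (hba | ⟨hb', ha', -⟩)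
    · rfl
    · rfl
    · exact hba.symm
    · exact (Set.disjoint_left.mp h.disjoint ha ha').elim

/-- The flag ideal of a bipartite graph, seen as a poset. -/
noncomputable def bipartiteFlagIdeal (K : Type*) [Field K] (h : G.IsBipartiteWith A B) :
    Ideal (MvPolynomial V K) :=
  @flagIdeal K V _ (bipartitePoset h)

/-- The graph consisting of two disjoint edges. -/
def twoDisjointEdges : SimpleGraph (Fin 2 ⊕ Fin 2) :=
  (⊤ : SimpleGraph (Fin 2)) ⊕g (⊤ : SimpleGraph (Fin 2))

/-- `G` is a Ferrers graph: its vertices can be labelled `x 0, …, x n, y 0, …, y m`, without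
repetition, such that every edge joins an `x` to a `y`, the edges form a Ferrers shape, and
`{x 0, y m}` and `{x n, y 0}` are edges. -/
def IsFerrersGraph (G : SimpleGraph V) : Prop :=
  ∃ (n m : ℕ) (e : Fin (n + 1) ⊕ Fin (m + 1) ≃ V),
    (∀ i j, ¬ G.Adj (e (.inl i)) (e (.inl j))) ∧
    (∀ i j, ¬ G.Adj (e (.inr i)) (e (.inr j))) ∧
    (∀ p q, G.Adj (e (.inl p)) (e (.inr q)) →
      ∀ i ≤ p, ∀ j ≤ q, G.Adj (e (.inl i)) (e (.inr j))) ∧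
    G.Adj (e (.inl 0)) (e (.inr (Fin.last m))) ∧
    G.Adj (e (.inl (Fin.last n))) (e (.inr 0))

end Graphs

end FlagIdeals

/-! Without isolated vertices the maximal chains are exactly the edges, so the flag ideal is the
edge ideal.

Ferrers implies linear: order the generators x_i y_j lexicographically. The colon ideal of the
earlier generators by x_i y_j is generated by the variables x_k with k < i and y_l with l < j; the
Ferrers shape supplies the edges needed. Families with this property ("variable quotients")
reproduce: their syzygies are generated by one linear syzygy for each pair of a generator and one of
its colon variables, and these, ordered lexicographically, again have variable quotients
(`VariableQuotients.syzygies`). Iteration gives a linear resolution.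

Linear implies no induced pair of disjoint edges: if pq and rs were such a pair, the Koszul relation
between x_p x_q and x_r x_s would not be generated by linear syzygies. A linear map `L` built from
the coefficients of x_p x_q in the generators detects this: it sends linear syzygies into the ideal
`Q` of the variables other than x_r, x_s, but sends the Koszul relation, modulo `Q`, to x_r x_s
times a polynomial with constant term 1.

No induced pair implies Ferrers: neighbourhoods of vertices on the same side are nested, so sorting
each side by decreasing degree gives the labelling. -/

namespace FlagIdeals

open MvPolynomial

/-! ### Maximal chains and the edge ideal -/

section EdgeIdeals

variable {V : Type*} {G : SimpleGraph V} {A B : Set V}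

/-- The edge ideal of a graph. -/
noncomputable def edgeIdeal (K : Type*) [Field K] (G : SimpleGraph V) :
    Ideal (MvPolynomial V K) :=
  Ideal.span {f | ∃ a b, G.Adj a b ∧ f = X a * X b}

/-- No element has others both above and below it, so an edge is a chain that cannot grow. Every
vertex lies on an edge, so chains with at most one element are not maximal. -/
lemma isMaxChain_bipartitePoset_iff (h : G.IsBipartiteWith A B) (hiso : ∀ v, ∃ w, G.Adj v w)
    [Nonempty V] (s : Set V) :
    IsMaxChain (bipartitePoset h).le s ↔ ∃ a ∈ A, ∃ b ∈ B, G.Adj a b ∧ s = {a, b} := by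
  have hAB : ∀ {x}, x ∈ A → x ∈ B → False := fun ha hb => Set.disjoint_left.mp h.disjoint ha hb
  have key : ∀ {t : Set V} {a b : V}, IsChain (bipartitePoset h).le t → a ∈ t → b ∈ t → a ∈ A →
      b ∈ B → G.Adj a b → t = {a, b} := by
    intro t a b ht hat hbt ha hb hab
    refine Set.Subset.antisymm (fun c hc => ?_) (by simp [Set.insert_subset_iff, hat, hbt])
    have h1 : (bipartitePoset h).le a c ∨ (bipartitePoset h).le c a := by
      rcases eq_or_ne a c with rfl | hne
      exacts [Or.inl (Or.inl rfl), ht hat hc hne]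
    have h2 : (bipartitePoset h).le b c ∨ (bipartitePoset h).le c b := by
      rcases eq_or_ne b c with rfl | hne
      exacts [Or.inl (Or.inl rfl), ht hbt hc hne]
    rcases h1 with (rfl | ⟨-, hc1, -⟩) | (rfl | ⟨-, ha', -⟩)
    · simp
    · rcases h2 with (rfl | ⟨hb', -, -⟩) | (rfl | ⟨hc', -, -⟩)
      · simp
      · exact (hAB hb' hb).elim
      · simp
      · exact (hAB hc' hc1).elim
    · simp
    · exact (hAB ha ha').elim
  have hpair : ∀ {a b : V}, a ∈ A → b ∈ B → G.Adj a b →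
      IsChain (bipartitePoset h).le ({a, b} : Set V) := by
    rintro a b ha hb hab x (rfl | rfl) y (rfl | rfl) hne
    · exact (hne rfl).elim
    · exact Or.inl (Or.inr ⟨ha, hb, hab⟩)
    · exact Or.inr (Or.inr ⟨ha, hb, hab⟩)
    · exact (hne rfl).elim
  have hextend : ∀ v, ∃ a ∈ A, ∃ b ∈ B, G.Adj a b ∧ v ∈ ({a, b} : Set V) := by
    intro v
    obtain ⟨w, hw⟩ := hiso v
    rcases h.mem_of_adj hw with ⟨hv, hw'⟩ | ⟨hv, hw'⟩
    · exact ⟨v, hv, w, hw', hw, by simp⟩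
    · exact ⟨w, hw', v, hv, hw.symm, by simp⟩
  constructor
  · rintro ⟨hc, hmax⟩
    -- The empty chain is treated with the singletons: it lies in `{v}` for an arbitrary vertex.
    by_cases hs : s.Subsingleton
    · obtain ⟨v, hv⟩ : ∃ v, s ⊆ {v} := by
        rcases hs.eq_empty_or_singleton with rfl | ⟨v, rfl⟩
        exacts [⟨Classical.arbitrary V, Set.empty_subset _⟩, ⟨v, subset_rfl⟩]
      obtain ⟨a, ha, b, hb, hab, hvab⟩ := hextend v
      exact ⟨a, ha, b, hb, hab,
        hmax (hpair ha hb hab) (hv.trans (Set.singleton_subset_iff.mpr hvab))⟩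
    · obtain ⟨x, hx, y, hy, hne⟩ := Set.not_subsingleton_iff.mp hs
      rcases hc hx hy hne with (rfl | ⟨h1, h2, h3⟩) | (rfl | ⟨h1, h2, h3⟩)
      · exact (hne rfl).elim
      · exact ⟨x, h1, y, h2, h3, key hc hx hy h1 h2 h3⟩
      · exact (hne rfl).elim
      · exact ⟨y, h1, x, h2, h3, key hc hy hx h1 h2 h3⟩
  · rintro ⟨a, ha, b, hb, hab, rfl⟩
    exact ⟨hpair ha hb hab, fun t ht hle =>
      (key ht (hle (by simp)) (hle (by simp)) ha hb hab).symm⟩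

lemma bipartiteFlagIdeal_eq_edgeIdeal (K : Type*) [Field K] [Nonempty V]
    (h : G.IsBipartiteWith A B) (hiso : ∀ v, ∃ w, G.Adj v w) :
    bipartiteFlagIdeal K h = edgeIdeal K G := by
  classical
  have hmax := isMaxChain_bipartitePoset_iff h hiso
  refine congrArg Ideal.span (Set.ext fun f => ⟨?_, ?_⟩)
  · rintro ⟨s, hs, rfl⟩
    obtain ⟨a, -, b, -, hab, hsab⟩ := (hmax s).mp hs
    obtain rfl : s = {a, b} := by
      apply Finset.coe_injective
      simpa using hsab
    exact ⟨a, b, hab, Finset.prod_pair hab.ne⟩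
  · have haux : ∀ a ∈ A, ∀ b ∈ B, G.Adj a b → ∃ s : Finset V,
        IsMaxChain (bipartitePoset h).le (s : Set V) ∧
        (X a * X b : MvPolynomial V K) = ∏ p ∈ s, X p := fun a ha b hb hab =>
      ⟨{a, b}, (hmax _).mpr ⟨a, ha, b, hb, hab, by simp⟩, (Finset.prod_pair hab.ne).symm⟩
    rintro ⟨a, b, hab, rfl⟩
    rcases h.mem_of_adj hab with ⟨ha, hb⟩ | ⟨hb, ha⟩
    · exact haux a ha b hb hab
    · rw [mul_comm]
      exact haux b ha a hb hab.symm

variable {K : Type*} [Field K]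

/-- The exponent of a monomial occurring in an element of the edge ideal is divisible by
an edge. -/
lemma exists_adj_of_mem_edgeIdeal {f : MvPolynomial V K} (hf : f ∈ edgeIdeal K G) {m : V →₀ ℕ}
    (hm : coeff m f ≠ 0) : ∃ a b, G.Adj a b ∧ m a ≠ 0 ∧ m b ≠ 0 := by
  have hI : edgeIdeal K G = Ideal.span ((fun s => monomial s (1 : K)) ''
      {s | ∃ a b, G.Adj a b ∧ s = Finsupp.single a 1 + Finsupp.single b 1}) := by
    refine congrArg Ideal.span (Set.ext fun g => ⟨?_, ?_⟩)
    · rintro ⟨a, b, hab, rfl⟩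
      exact ⟨_, ⟨a, b, hab, rfl⟩, by simp [X, monomial_mul]⟩
    · rintro ⟨_, ⟨a, b, hab, rfl⟩, rfl⟩
      exact ⟨a, b, hab, by simp [X, monomial_mul]⟩
  rw [hI, mem_ideal_span_monomial_image] at hf
  obtain ⟨_, ⟨a, b, hab, rfl⟩, hle⟩ := hf m (mem_support_iff.mpr hm)
  refine ⟨a, b, hab, ?_, ?_⟩
  · have := hle a
    simp at this
    omega
  · have := hle b
    simp at this
    omega

end EdgeIdeals

/-! ### Syzygies of families with variable quotients -/

section SyzygiesOfVariableQuotients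

variable {σ W ι κ K : Type*} [Field K]

/-- Variables outside a set are non-zero-divisors modulo the ideal generated by the variables
in the set. -/
lemma mem_span_X_of_mul_X_mem {s : Set σ} {a : σ} (ha : a ∉ s) {f : MvPolynomial σ K}
    (h : f * X a ∈ Ideal.span (X '' s : Set (MvPolynomial σ K))) :
    f ∈ Ideal.span (X '' s : Set (MvPolynomial σ K)) := by
  classical
  rw [mem_ideal_span_X_image] at h ⊢
  intro m hm
  obtain ⟨i, hi, hne⟩ := h (m + Finsupp.single a 1) (by
    rw [mem_support_iff, coeff_mul_X]
    exact mem_support_iff.mp hm)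
  refine ⟨i, hi, ?_⟩
  have hia : a ≠ i := fun h' => ha (h' ▸ hi)
  simpa [Finsupp.single_apply, hia] using hne

/-- Used to cut a relation among vectors of degree `d` down to its part with linear coefficients. -/
lemma homogeneousComponent_mul_right {f g : MvPolynomial σ K} {d : ℕ} (hg : g.IsHomogeneous d)
    (n : ℕ) : homogeneousComponent (n + d) (f * g) = homogeneousComponent n f * g := by
  classical
  let _ := gradedAlgebra (σ := σ) (R := K)
  have h1 := DirectSum.coe_decompose_mul_add_of_right_mem (homogeneousSubmodule σ K)
    (a := f) (b := g) (i := n) (j := d) hg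
  rw [← decomposition.decompose'_apply, ← decomposition.decompose'_apply]
  exact h1

/-- The colon ideals `(m i, i < j) : m j` are generated by the variables `X (v s)`, `s ∈ S j`. -/
def VariableQuotients (K : Type*) [Field K] {M : Type*} [AddCommGroup M] [Module (MvPolynomial σ K) M] [LinearOrder ι]
    (v : W → σ) (m : ι → M) (S : ι → Set W) : Prop :=
  ∀ j (f : MvPolynomial σ K), f • m j ∈ Submodule.span (MvPolynomial σ K) (m '' Set.Iio j) ↔
    f ∈ Ideal.span (X '' (v '' S j) : Set (MvPolynomial σ K))

/-- For vectors with homogeneous entries of a common degree, the relations witnessing the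
colon ideals can be chosen with linear coefficients. -/
lemma VariableQuotients.exists_linear_relation [LinearOrder ι] {v : W → σ}
    {m : ι → κ →₀ MvPolynomial σ K} {S : ι → Set W} (h : VariableQuotients K v m S) {d : ℕ}
    (hm : ∀ j c, (m j c).IsHomogeneous d) {j : ι} {s : W} (hs : s ∈ S j) :
    ∃ l : ι →₀ MvPolynomial σ K, (∀ i, (l i).IsHomogeneous 1) ∧ (∀ i, j ≤ i → l i = 0) ∧
      Finsupp.linearCombination (MvPolynomial σ K) m l = (X (v s) : MvPolynomial σ K) • m j := by
  classical
  have hX : (X (v s) : MvPolynomial σ K) • m j ∈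
      Submodule.span (MvPolynomial σ K) (m '' Set.Iio j) :=
    (h j _).mpr (Ideal.subset_span ⟨_, ⟨s, hs, rfl⟩, rfl⟩)
  obtain ⟨l, hl, hlm⟩ :=
    (Finsupp.mem_span_image_iff_linearCombination (MvPolynomial σ K)).mp hX
  -- Keep only the linear part of each coefficient. The right-hand side already lives in degree `1 +
  -- d`, so the relation survives.
  refine ⟨l.mapRange (homogeneousComponent (R := K) 1) (map_zero (homogeneousComponent (R := K) 1)),
    fun i => homogeneousComponent_isHomogeneous 1 (l i), fun i hi => ?_, ?_⟩
  · have : l i = 0 := by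
      by_contra hne
      exact absurd (hl (Finsupp.mem_support_iff.mpr hne)) (by simpa using hi)
    simp [this]
  · ext1 c
    have hc := congrArg (fun y => homogeneousComponent (1 + d) (y c)) hlm
    simp only [Finsupp.linearCombination_apply, Finsupp.sum, Finsupp.finsetSum_apply,
      Finsupp.smul_apply, smul_eq_mul, map_sum, homogeneousComponent_mul_right (hm _ c)] at hc
    rw [homogeneousComponent_of_mem (m := 1) (isHomogeneous_X K (v s)), if_pos rfl] at hc
    rw [Finsupp.linearCombination_apply, Finsupp.sum_mapRange_index (by simp),
      Finsupp.sum, Finsupp.finsetSum_apply]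
    simpa using hc

/-- The index set of the generators of the syzygies of a family with variable quotients. -/
abbrev SyzygyIndex (S : ι → Set W) : Type _ :=
  {p : ι ×ₗ W // (ofLex p).2 ∈ S (ofLex p).1}

variable [LinearOrder ι] [LinearOrder W] {M : Type*} [AddCommGroup M]
  [Module (MvPolynomial σ K) M] {v : W → σ} {m : ι → M} {S : ι → Set W}
  {z : SyzygyIndex S → ι →₀ MvPolynomial σ K}

-- Projection to coordinate `j` sends the syzygies with leading position `j` to the variables
-- generating the colon ideal, so every element of that ideal is the leading entry of a combination
-- of them.
omit [LinearOrder ι] [LinearOrder W] in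
lemma exists_mem_span_apply_eq (hz : ∀ p, z p (ofLex p.1).1 = X (v (ofLex p.1).2)) (j : ι)
    {f : MvPolynomial σ K} (hf : f ∈ Ideal.span (X '' (v '' S j) : Set (MvPolynomial σ K))) :
    ∃ g ∈ Submodule.span (MvPolynomial σ K) (z '' {p | (ofLex p.1).1 = j}), g j = f := by
  suffices h : Ideal.span (X '' (v '' S j) : Set (MvPolynomial σ K)) ≤
      (Submodule.span (MvPolynomial σ K) (z '' {p | (ofLex p.1).1 = j})).map
        (Finsupp.lapply j) by
    obtain ⟨g, hg, rfl⟩ := h hf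
    exact ⟨g, hg, rfl⟩
  refine Submodule.span_le.mpr ?_
  rintro _ ⟨_, ⟨s, hs, rfl⟩, rfl⟩
  exact ⟨_, Submodule.subset_span ⟨⟨toLex (j, s), hs⟩, rfl, rfl⟩, hz ⟨toLex (j, s), hs⟩⟩

-- Elimination from the top: the entry of `g` at `k` lies in the colon ideal, so a combination `y`
-- of syzygies with leading position `k` cancels it, and `g - y` is supported strictly below `k`.
omit [LinearOrder W] in
lemma VariableQuotients.mem_span_syzygies_of_le [Finite ι] (h : VariableQuotients K v m S)
    (hz : ∀ p, z p (ofLex p.1).1 = X (v (ofLex p.1).2))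
    (hz' : ∀ p i, (ofLex p.1).1 < i → z p i = 0)
    (hker : ∀ p, Finsupp.linearCombination (MvPolynomial σ K) m (z p) = 0) (k : ι) :
    ∀ g : ι →₀ MvPolynomial σ K, (∀ i, k < i → g i = 0) →
      Finsupp.linearCombination (MvPolynomial σ K) m g = 0 →
      g ∈ Submodule.span (MvPolynomial σ K) (z '' {p | (ofLex p.1).1 ≤ k}) := by
  classical
  induction k using (Finite.to_wellFoundedLT (α := ι)).wf.induction with
  | _ k ih =>
  intro g hgk hg
  have hmem : g k • m k ∈ Submodule.span (MvPolynomial σ K) (m '' Set.Iio k) := by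
    have hsplit : g k • m k =
        -Finsupp.linearCombination (MvPolynomial σ K) m (g.erase k) := by
      rw [← Finsupp.single_add_erase k g, map_add, Finsupp.linearCombination_single] at hg
      exact eq_neg_of_add_eq_zero_left hg
    rw [hsplit]
    refine neg_mem ((Finsupp.mem_span_image_iff_linearCombination (MvPolynomial σ K)).mpr ⟨_, ?_, rfl⟩)
    intro i hi
    have hi' : i ≠ k ∧ g i ≠ 0 := by
      simpa [and_comm] using hi
    exact lt_of_le_of_ne (not_lt.mp fun hlt => hi'.2 (hgk i hlt)) hi'.1
  obtain ⟨y, hy, hyk⟩ := exists_mem_span_apply_eq hz k ((h k (g k)).mp hmem)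
  have hyker : Finsupp.linearCombination (MvPolynomial σ K) m y = 0 := by
    have hle : Submodule.span (MvPolynomial σ K) (z '' {p | (ofLex p.1).1 = k}) ≤
        LinearMap.ker (Finsupp.linearCombination (MvPolynomial σ K) m) := by
      refine Submodule.span_le.mpr ?_
      rintro _ ⟨p, -, rfl⟩
      exact hker p
    exact hle hy
  have hysupp : ∀ i, k < i → y i = 0 := by
    intro i hi
    have hle : Submodule.span (MvPolynomial σ K) (z '' {p | (ofLex p.1).1 = k}) ≤
        LinearMap.ker (Finsupp.lapply i) := by
      refine Submodule.span_le.mpr ?_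
      rintro _ ⟨p, hp, rfl⟩
      exact hz' p i (lt_of_eq_of_lt hp hi)
    exact hle hy
  rw [← sub_add_cancel g y]
  refine add_mem ?_ (Submodule.span_mono (Set.image_mono fun p hp => le_of_eq hp) hy)
  rcases (g - y).support.eq_empty_or_nonempty with hempty | hne
  · rw [Finsupp.support_eq_empty.mp hempty]
    exact zero_mem _
  · have hsupp : ∀ i ∈ (g - y).support, i < k := by
      intro i hi
      by_contra hik
      refine Finsupp.mem_support_iff.mp hi ?_
      rcases (not_lt.mp hik).eq_or_lt with rfl | hlt
      · simp [hyk]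
      · simp [hgk i hlt, hysupp i hlt]
    have hlt := hsupp _ (Finset.max'_mem _ hne)
    refine Submodule.span_mono (Set.image_mono fun p hp => le_trans hp hlt.le)
      (ih _ hlt (g - y) (fun i hi => ?_) (by rw [map_sub, hg, hyker, sub_zero]))
    by_contra hi'
    exact absurd (Finset.le_max' _ i (Finsupp.mem_support_iff.mpr hi')) (not_le.mpr hi)

-- The bound on leading positions is what later shows that only lexicographically earlier syzygies
-- are used.
omit [LinearOrder W] in
lemma VariableQuotients.mem_span_syzygies [Finite ι] (h : VariableQuotients K v m S)
    (hz : ∀ p, z p (ofLex p.1).1 = X (v (ofLex p.1).2))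
    (hz' : ∀ p i, (ofLex p.1).1 < i → z p i = 0)
    (hker : ∀ p, Finsupp.linearCombination (MvPolynomial σ K) m (z p) = 0)
    {g : ι →₀ MvPolynomial σ K} (hg : Finsupp.linearCombination (MvPolynomial σ K) m g = 0) :
    g ∈ Submodule.span (MvPolynomial σ K)
      (z '' {p | ∃ i ∈ g.support, (ofLex p.1).1 ≤ i}) := by
  rcases g.support.eq_empty_or_nonempty with hempty | hne
  · rw [Finsupp.support_eq_empty.mp hempty]
    exact zero_mem _
  · refine Submodule.span_mono
      (Set.image_mono fun p hp => Exists.intro _ ⟨Finset.max'_mem _ hne, hp⟩)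
      (h.mem_span_syzygies_of_le hz hz' hker (g.support.max' hne) g (fun i hi => ?_) hg)
    by_contra hi'
    exact absurd (Finset.le_max' _ i (Finsupp.mem_support_iff.mpr hi')) (not_le.mpr hi)

/-- The syzygies of a family with variable quotients again have variable quotients. -/
lemma VariableQuotients.syzygies [Finite ι] (hv : Function.Injective v)
    (h : VariableQuotients K v m S)
    (hz : ∀ p, z p (ofLex p.1).1 = X (v (ofLex p.1).2))
    (hz' : ∀ p i, (ofLex p.1).1 < i → z p i = 0)
    (hker : ∀ p, Finsupp.linearCombination (MvPolynomial σ K) m (z p) = 0) :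
    VariableQuotients K v z
      (fun p : SyzygyIndex S => {s | s ∈ S (ofLex p.1).1 ∧ s < (ofLex p.1).2}) := by
  classical
  rintro ⟨p, hp⟩ f
  obtain ⟨⟨j, s⟩, rfl⟩ := toLex.surjective p
  simp only [ofLex_toLex] at hp ⊢
  constructor
  · intro hf
    -- Compare coordinates at `j`: earlier syzygies have entry 0 or `X (v t)` with `t < s` there,
    -- while the current one has `X (v s)`, which can be cancelled.
    refine mem_span_X_of_mul_X_mem (a := v s) ?_ ?_
    · rintro ⟨s', hs', hvs⟩
      exact absurd (hv hvs) hs'.2.ne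
    · have hle : Submodule.span (MvPolynomial σ K) (z '' Set.Iio ⟨toLex (j, s), hp⟩) ≤
          Submodule.comap (Finsupp.lapply j)
            (Ideal.span (X '' (v '' {t | t ∈ S j ∧ t < s}) : Set (MvPolynomial σ K))) := by
        refine Submodule.span_le.mpr ?_
        rintro _ ⟨⟨q, hq⟩, hlt, rfl⟩
        obtain ⟨⟨i, t⟩, rfl⟩ := toLex.surjective q
        have hlt' : toLex (i, t) < toLex (j, s) := hlt
        rcases Prod.Lex.toLex_lt_toLex.mp hlt' with hij | ⟨hij, hts⟩
        · have : z ⟨toLex (i, t), hq⟩ j = 0 := hz' ⟨toLex (i, t), hq⟩ j hij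
          simp [this]
        · obtain rfl : i = j := hij
          have : z ⟨toLex (i, t), hq⟩ i = X (v t) := hz ⟨toLex (i, t), hq⟩
          simp only [SetLike.mem_coe, Submodule.mem_comap, Finsupp.lapply_apply, this]
          exact Ideal.subset_span ⟨_, ⟨t, ⟨hq, hts⟩, rfl⟩, rfl⟩
      have := hle hf
      have hzj : z ⟨toLex (j, s), hp⟩ j = X (v s) := hz ⟨toLex (j, s), hp⟩
      simpa [hzj] using this
  · suffices hle : Ideal.span (X '' (v '' {t | t ∈ S j ∧ t < s}) : Set (MvPolynomial σ K)) ≤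
        (Submodule.span (MvPolynomial σ K) (z '' Set.Iio ⟨toLex (j, s), hp⟩)).comap
          (LinearMap.toSpanSingleton _ _ (z ⟨toLex (j, s), hp⟩)) by
      exact fun hf => hle hf
    refine Submodule.span_le.mpr ?_
    rintro _ ⟨_, ⟨t, ⟨ht, hts⟩, rfl⟩, rfl⟩
    set p : SyzygyIndex S := ⟨toLex (j, s), hp⟩
    set q : SyzygyIndex S := ⟨toLex (j, t), ht⟩
    have hqp : q < p := Prod.Lex.toLex_lt_toLex.mpr (Or.inr ⟨rfl, hts⟩)
    change (X (v t) : MvPolynomial σ K) • z p ∈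
      Submodule.span (MvPolynomial σ K) (z '' Set.Iio p)
    -- The difference `X (v t) • z p - X (v s) • z q` is a syzygy whose entries at `j` cancel. It is
    -- supported below `j`, so it is generated by syzygies preceding `p`.
    rw [← sub_add_cancel ((X (v t) : MvPolynomial σ K) • z p) ((X (v s) : MvPolynomial σ K) • z q)]
    refine add_mem ?_ (Submodule.smul_mem _ _ (Submodule.subset_span ⟨q, hqp, rfl⟩))
    refine Submodule.span_mono (Set.image_mono ?_)
      (h.mem_span_syzygies hz hz' hker (by rw [map_sub, map_smul, map_smul, hker, hker]; simp))
    rintro ⟨r, hr⟩ ⟨i, hi, hri⟩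
    refine Prod.Lex.lt_iff.mpr (Or.inl (lt_of_le_of_lt hri ?_))
    change i < j
    by_contra hij
    refine Finsupp.mem_support_iff.mp hi ?_
    rcases (not_lt.mp hij).eq_or_lt with rfl | hlt
    · have h1 : z p j = X (v s) := hz p
      have h2 : z q j = X (v t) := hz q
      simp [h1, h2, mul_comm]
    · have h1 : z p i = 0 := hz' p i hlt
      have h2 : z q i = 0 := hz' q i hlt
      simp [h1, h2]

/-- A family of vectors with homogeneous entries and variable quotients has a generating family
of syzygies with linear entries and variable quotients. -/
lemma VariableQuotients.exists_syzygies [Finite ι] (hv : Function.Injective v)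
    {m : ι → κ →₀ MvPolynomial σ K} (h : VariableQuotients K v m S) {d : ℕ}
    (hm : ∀ j c, (m j c).IsHomogeneous d) :
    ∃ z : SyzygyIndex S → ι →₀ MvPolynomial σ K,
      VariableQuotients K v z (fun p : SyzygyIndex S => {s | s ∈ S (ofLex p.1).1 ∧ s < (ofLex p.1).2}) ∧
      (∀ p i, (z p i).IsHomogeneous 1) ∧
      Function.Exact (Finsupp.linearCombination (MvPolynomial σ K) z)
        (Finsupp.linearCombination (MvPolynomial σ K) m) := by
  classical
  choose l hl1 hl2 hl3 using fun p : SyzygyIndex S => h.exists_linear_relation hm p.2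
  let z : SyzygyIndex S → ι →₀ MvPolynomial σ K := fun p =>
    Finsupp.single (ofLex p.1).1 (X (v (ofLex p.1).2)) - l p
  have hz : ∀ p, z p (ofLex p.1).1 = X (v (ofLex p.1).2) := fun p => by
    simp [z, hl2 p _ le_rfl]
  have hz' : ∀ p i, (ofLex p.1).1 < i → z p i = 0 := fun p i hi => by
    simp [z, hl2 p i hi.le, hi.ne]
  have hker : ∀ p, Finsupp.linearCombination (MvPolynomial σ K) m (z p) = 0 := fun p => by
    simp only [z]
    rw [map_sub, hl3, Finsupp.linearCombination_single, sub_self]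
  refine ⟨z, h.syzygies hv hz hz' hker, fun p i => ?_, fun g => ⟨fun hg => ?_, ?_⟩⟩
  · refine IsHomogeneous.sub ?_ (hl1 p i)
    rw [Finsupp.single_apply]
    split_ifs
    exacts [isHomogeneous_X K _, isHomogeneous_zero _ _ _]
  · have := Submodule.span_mono (Set.image_subset_range _ _) (h.mem_span_syzygies hz hz' hker hg)
    rwa [← Finsupp.range_linearCombination] at this
  · rintro ⟨y, rfl⟩
    have : Finsupp.linearCombination (MvPolynomial σ K) m ∘ₗ
        Finsupp.linearCombination (MvPolynomial σ K) z = 0 := by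
      ext1 p
      ext1
      simpa using hker p
    exact LinearMap.congr_fun this y

end SyzygiesOfVariableQuotients

/-! ### Iterated syzygies and linear resolutions -/

section LinearResolutionsFromVariableQuotients

variable {σ K : Type*} {W : Type} [Field K] [LinearOrder W] {v : W → σ}

/-- A finite family of vectors over a polynomial ring, homogeneous of a common degree, with
variable quotients. -/
structure VariableQuotientFamily (K : Type*) [Field K] (v : W → σ) where
  coord : Type
  index : Type
  linearOrder : LinearOrder index
  finite : Finite index
  vec : index → coord →₀ MvPolynomial σ K
  quot : index → Set W
  variableQuotients : VariableQuotients K v vec quot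
  deg : ℕ
  isHomogeneous : ∀ j c, (vec j c).IsHomogeneous deg

attribute [instance] VariableQuotientFamily.linearOrder VariableQuotientFamily.finite

namespace VariableQuotientFamily

variable [Finite W] (hv : Function.Injective v)

/-- The family of linear syzygies. -/
noncomputable def syzygy (F : VariableQuotientFamily K v) : VariableQuotientFamily K v where
  coord := F.index
  index := SyzygyIndex F.quot
  linearOrder := inferInstance
  finite := haveI : Finite (F.index ×ₗ W) := inferInstanceAs (Finite (F.index × W))
    inferInstance
  vec := (F.variableQuotients.exists_syzygies hv F.isHomogeneous).choose
  quot := _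
  variableQuotients :=
    (F.variableQuotients.exists_syzygies hv F.isHomogeneous).choose_spec.1
  deg := 1
  isHomogeneous := (F.variableQuotients.exists_syzygies hv F.isHomogeneous).choose_spec.2.1

lemma exact_syzygy (F : VariableQuotientFamily K v) :
    Function.Exact (Finsupp.linearCombination (MvPolynomial σ K) (F.syzygy hv).vec)
      (Finsupp.linearCombination (MvPolynomial σ K) F.vec) :=
  (F.variableQuotients.exists_syzygies hv F.isHomogeneous).choose_spec.2.2

/-- The iterated syzygies. -/
noncomputable def iterSyzygy (F : VariableQuotientFamily K v) : ℕ → VariableQuotientFamily K v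
  | 0 => F
  | i + 1 => (iterSyzygy F i).syzygy hv

end VariableQuotientFamily

lemma linearCombination_single_one {R M α : Type*} [Semiring R] [AddCommMonoid M] [Module R M]
    (f : α → M) (k : α) : Finsupp.linearCombination R f (Finsupp.single k 1) = f k := by
  simp

/-- An ideal generated by finitely many polynomials of the same degree with variable quotients
has a linear resolution. -/
theorem VariableQuotients.hasLinearResolution [Finite W] (hv : Function.Injective v) {ι : Type}
    [LinearOrder ι] [Finite ι] {f : ι → MvPolynomial σ K} {S : ι → Set W}
    (h : VariableQuotients K v f S) {t : ℕ} (hf : ∀ j, (f j).IsHomogeneous t) :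
    HasLinearResolution (Ideal.span (Set.range f)) := by
  -- Polynomials are viewed as vectors with one coordinate, so that the iteration can start from
  -- them.
  let e : MvPolynomial σ K →ₗ[MvPolynomial σ K] (Unit →₀ MvPolynomial σ K) :=
    Finsupp.lsingle ()
  have he : Function.Injective e := Finsupp.single_injective ()
  let F : VariableQuotientFamily K v :=
    { coord := Unit
      index := ι
      linearOrder := inferInstance
      finite := inferInstance
      vec := fun j => e (f j)
      quot := S
      variableQuotients := fun j g => by
        rw [← h j g, ← map_smul, ← Set.image_image e f, ← Submodule.map_span]
        exact he.mem_set_image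
      deg := t
      isHomogeneous := fun j c => by simpa [e] using hf j }
  let s := F.iterSyzygy hv
  have hdeg : ∀ i, (s (i + 1)).deg = 1 := fun i => rfl
  have haug : Finsupp.linearCombination (MvPolynomial σ K) F.vec =
      e ∘ₗ Finsupp.linearCombination (MvPolynomial σ K) f := by
    ext1 j
    ext1
    simp [F]
  let R : GradedFreeResolution (Ideal.span (Set.range f)) :=
    { ι := fun i => (s i).index
      finite_ι := fun i => (s i).finite
      deg := fun i _ => t + i
      aug := Finsupp.linearCombination (MvPolynomial σ K) f
      d := fun i => Finsupp.linearCombination (MvPolynomial σ K) (s (i + 1)).vec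
      aug_homogeneous := fun k => by
        have hk := hf k
        rw [← linearCombination_single_one (R := MvPolynomial σ K) f k] at hk
        exact hk
      d_homogeneous := fun i k j => Or.inr ⟨1, add_assoc t i 1 |>.symm, by
        have hk := (s (i + 1)).isHomogeneous k j
        rw [← linearCombination_single_one (R := MvPolynomial σ K) (s (i + 1)).vec k] at hk
        exact hk⟩
      range_aug := Finsupp.range_linearCombination _
      exact_zero := fun y => by
        have := F.exact_syzygy hv y
        rw [haug] at this
        exact (map_eq_zero_iff e he).symm.trans this
      exact_succ := fun i => (s (i + 1)).exact_syzygy hv }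
  refine ⟨t, R, fun i k j => ?_, fun i k => rfl⟩
  have hR : R.d i (Finsupp.single k 1) j = (s (i + 1)).vec k j := by
    change Finsupp.linearCombination (MvPolynomial σ K) (s (i + 1)).vec (Finsupp.single k 1) j = _
    rw [Finsupp.linearCombination_single, one_smul]
  rw [hR]
  -- All matrix entries are linear forms, hence have no constant term.
  exact ((s (i + 1)).isHomogeneous k j).coeff_eq_zero (by rw [hdeg]; simp)

end LinearResolutionsFromVariableQuotients

/-! ### Linear resolutions for Ferrers graphs -/

section FerrersGraphs

variable {V : Type*} {G : SimpleGraph V} (K : Type*) [Field K]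

/-- The edge ideal of a Ferrers graph has a linear resolution. -/
theorem IsFerrersGraph.hasLinearResolution (hG : IsFerrersGraph G) :
    HasLinearResolution (edgeIdeal K G) := by
  obtain ⟨n, m, e, hx, hy, hxy, -, -⟩ := hG
  let ι : Type := {p : Fin (n + 1) ×ₗ Fin (m + 1) //
    G.Adj (e (.inl (ofLex p).1)) (e (.inr (ofLex p).2))}
  have : Finite (Fin (n + 1) ×ₗ Fin (m + 1)) :=
    inferInstanceAs (Finite (Fin (n + 1) × Fin (m + 1)))
  let f : ι → MvPolynomial V K := fun p => X (e (.inl (ofLex p.1).1)) * X (e (.inr (ofLex p.1).2))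
  -- The lexicographic sum only provides some linear order on the variables, needed to order the
  -- syzygies.
  let v : Fin (n + 1) ⊕ₗ Fin (m + 1) → V := fun w => e (ofLex w)
  have hv : Function.Injective v := e.injective.comp ofLex.injective
  let S : ι → Set (Fin (n + 1) ⊕ₗ Fin (m + 1)) := fun p =>
    {w | (∃ i < (ofLex p.1).1, w = toLex (.inl i)) ∨ ∃ j < (ofLex p.1).2, w = toLex (.inr j)}
  have hS : VariableQuotients K v f S := by
    rintro ⟨p, hp⟩ g
    obtain ⟨⟨p, q⟩, rfl⟩ := toLex.surjective p
    simp only [ofLex_toLex] at hp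
    constructor
    · intro hg
      have hle : Submodule.span (MvPolynomial V K) (f '' Set.Iio ⟨toLex (p, q), hp⟩) ≤
          Ideal.span (X '' (v '' S ⟨toLex (p, q), hp⟩) : Set (MvPolynomial V K)) := by
        refine Submodule.span_le.mpr ?_
        rintro _ ⟨⟨r, hr⟩, hlt, rfl⟩
        obtain ⟨⟨i, j⟩, rfl⟩ := toLex.surjective r
        have hlt' : toLex (i, j) < toLex (p, q) := hlt
        rcases Prod.Lex.toLex_lt_toLex.mp hlt' with hip | ⟨-, hjq⟩
        · exact Ideal.mul_mem_right _ _
            (Ideal.subset_span ⟨_, ⟨toLex (.inl i), Or.inl ⟨i, hip, rfl⟩, rfl⟩, rfl⟩)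
        · exact Ideal.mul_mem_left _ _
            (Ideal.subset_span ⟨_, ⟨toLex (.inr j), Or.inr ⟨j, hjq, rfl⟩, rfl⟩, rfl⟩)
      have hmem := hle hg
      have hmul : g • f ⟨toLex (p, q), hp⟩ = g * X (e (.inl p)) * X (e (.inr q)) := by
        simp only [smul_eq_mul, f, ofLex_toLex, mul_assoc]
      rw [hmul] at hmem
      refine mem_span_X_of_mul_X_mem (a := e (.inl p)) ?_
        (mem_span_X_of_mul_X_mem (a := e (.inr q)) ?_ hmem)
      · rintro ⟨w, ⟨i, hi, rfl⟩ | ⟨j, hj, rfl⟩, hw⟩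
        · exact absurd (Sum.inl_injective (e.injective hw)) (ne_of_lt hi)
        · exact absurd (e.injective hw) (by simp)
      · rintro ⟨w, ⟨i, hi, rfl⟩ | ⟨j, hj, rfl⟩, hw⟩
        · exact absurd (e.injective hw) (by simp)
        · exact absurd (Sum.inr_injective (e.injective hw)) (ne_of_lt hj)
    · suffices hle : Ideal.span (X '' (v '' S ⟨toLex (p, q), hp⟩) : Set (MvPolynomial V K)) ≤
          (Submodule.span (MvPolynomial V K) (f '' Set.Iio ⟨toLex (p, q), hp⟩)).comap
            (LinearMap.toSpanSingleton _ _ (f ⟨toLex (p, q), hp⟩)) by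
        exact fun hg => hle hg
      refine Submodule.span_le.mpr ?_
      rintro _ ⟨_, ⟨w, ⟨i, hi, rfl⟩ | ⟨j, hj, rfl⟩, rfl⟩, rfl⟩
      · have hi' : i < p := hi
        have hadj : G.Adj (e (.inl i)) (e (.inr q)) := hxy p q hp i hi'.le q le_rfl
        have hlt : (⟨toLex (i, q), hadj⟩ : ι) < ⟨toLex (p, q), hp⟩ :=
          Prod.Lex.toLex_lt_toLex.mpr (Or.inl hi')
        have heq : (X (e (.inl i)) : MvPolynomial V K) * f ⟨toLex (p, q), hp⟩ =
            X (e (.inl p)) * f ⟨toLex (i, q), hadj⟩ := by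
          simp only [f, ofLex_toLex]
          ring
        change (X (e (.inl i)) : MvPolynomial V K) * f ⟨toLex (p, q), hp⟩ ∈
          Submodule.span (MvPolynomial V K) (f '' Set.Iio ⟨toLex (p, q), hp⟩)
        rw [heq]
        exact Submodule.smul_mem _ _ (Submodule.subset_span ⟨_, hlt, rfl⟩)
      · have hj' : j < q := hj
        have hadj : G.Adj (e (.inl p)) (e (.inr j)) := hxy p q hp p le_rfl j hj'.le
        have hlt : (⟨toLex (p, j), hadj⟩ : ι) < ⟨toLex (p, q), hp⟩ :=
          Prod.Lex.toLex_lt_toLex.mpr (Or.inr ⟨rfl, hj'⟩)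
        have heq : (X (e (.inr j)) : MvPolynomial V K) * f ⟨toLex (p, q), hp⟩ =
            X (e (.inr q)) * f ⟨toLex (p, j), hadj⟩ := by
          simp only [f, ofLex_toLex]
          ring
        change (X (e (.inr j)) : MvPolynomial V K) * f ⟨toLex (p, q), hp⟩ ∈
          Submodule.span (MvPolynomial V K) (f '' Set.Iio ⟨toLex (p, q), hp⟩)
        rw [heq]
        exact Submodule.smul_mem _ _ (Submodule.subset_span ⟨_, hlt, rfl⟩)
  have hrange : edgeIdeal K G = Ideal.span (Set.range f) := by
    refine congrArg Ideal.span (Set.ext fun g => ⟨?_, ?_⟩)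
    · rintro ⟨a, b, hab, rfl⟩
      obtain ⟨a, rfl⟩ := e.surjective a
      obtain ⟨b, rfl⟩ := e.surjective b
      rcases a with i | i <;> rcases b with j | j
      · exact (hx i j hab).elim
      · exact ⟨⟨toLex (i, j), hab⟩, rfl⟩
      · exact ⟨⟨toLex (j, i), hab.symm⟩, mul_comm _ _⟩
      · exact (hy i j hab).elim
    · rintro ⟨p, rfl⟩
      exact ⟨_, _, p.2, rfl⟩
  rw [hrange]
  have : Finite (Fin (n + 1) ⊕ₗ Fin (m + 1)) :=
    inferInstanceAs (Finite (Fin (n + 1) ⊕ Fin (m + 1)))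
  exact hS.hasLinearResolution hv (t := 2) fun j => (isHomogeneous_X K _).mul (isHomogeneous_X K _)

end FerrersGraphs

/-! ### Ferrers labellings from nested neighbourhoods -/

section Combinatorics

variable {V : Type*} {G : SimpleGraph V} {A B : Set V}

/-- A graph contains no induced pair of disjoint edges if and only if any two edges share a
vertex or are joined by an edge. -/
lemma twoDisjointEdges_isIndContained_iff :
    SimpleGraph.IsIndContained twoDisjointEdges G ↔ ∃ a b c d, G.Adj a b ∧ G.Adj c d ∧
      a ≠ c ∧ a ≠ d ∧ b ≠ c ∧ b ≠ d ∧
      ¬ G.Adj a c ∧ ¬ G.Adj a d ∧ ¬ G.Adj b c ∧ ¬ G.Adj b d := by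
  constructor
  · rintro ⟨f⟩
    have hadj : ∀ x y, G.Adj (f x) (f y) ↔ twoDisjointEdges.Adj x y := fun _ _ => f.map_adj_iff
    have hinj : ∀ x y, f x = f y ↔ x = y := fun _ _ => f.injective.eq_iff
    refine ⟨f (.inl 0), f (.inl 1), f (.inr 0), f (.inr 1), (hadj _ _).mpr ?_, (hadj _ _).mpr ?_,
      (hinj _ _).not.mpr ?_, (hinj _ _).not.mpr ?_, (hinj _ _).not.mpr ?_, (hinj _ _).not.mpr ?_,
      (hadj _ _).not.mpr ?_, (hadj _ _).not.mpr ?_, (hadj _ _).not.mpr ?_, (hadj _ _).not.mpr ?_⟩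
    all_goals simp [twoDisjointEdges]
  · rintro ⟨a, b, c, d, hab, hcd, h1, h2, h3, h4, h5, h6, h7, h8⟩
    refine ⟨⟨⟨Sum.elim ![a, b] ![c, d], ?_⟩, ?_⟩⟩
    · rintro (i | i) (j | j) <;> fin_cases i <;> fin_cases j <;>
        simp [hab.ne, hab.ne', hcd.ne, hcd.ne', h1, h2, h3, h4, h1.symm, h2.symm, h3.symm, h4.symm]
    · change ∀ {x y}, G.Adj (Sum.elim ![a, b] ![c, d] x) (Sum.elim ![a, b] ![c, d] y) ↔
        twoDisjointEdges.Adj x y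
      rintro (i | i) (j | j) <;> fin_cases i <;> fin_cases j <;>
        simp [twoDisjointEdges, hab, hab.symm, hcd, hcd.symm, h5, h6, h7, h8, G.adj_comm c,
          G.adj_comm d]

/-- The elements of a finite nonempty type can be listed by non-increasing values of a function. -/
lemma exists_equiv_fin_antitone {α : Type*} [Finite α] [Nonempty α] (f : α → ℕ) :
    ∃ (n : ℕ) (e : Fin (n + 1) ≃ α), Antitone (f ∘ e) := by
  obtain ⟨n, hn⟩ := Nat.exists_eq_succ_of_ne_zero (Nat.card_pos (α := α)).ne'
  let e := (Finite.equivFinOfCardEq hn).symm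
  refine ⟨n, (Tuple.sort (OrderDual.toDual ∘ f ∘ e)).trans e, fun i j hij => ?_⟩
  exact Tuple.monotone_sort (OrderDual.toDual ∘ f ∘ e) hij

lemma IsFerrersGraph.of_not_isIndContained [Finite V] [Nonempty V] (h : G.IsBipartiteWith A B)
    (hiso : ∀ v, ∃ w, G.Adj v w) (hG : ¬ SimpleGraph.IsIndContained twoDisjointEdges G) :
    IsFerrersGraph G := by
  classical
  have hAB : ∀ {x}, x ∈ A → x ∈ B → False := fun ha hb => Set.disjoint_left.mp h.disjoint ha hb
  have hA : ∀ {a b}, G.Adj a b → a ∈ A → b ∈ B := fun hab ha =>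
    (h.mem_of_adj hab).elim (·.2) fun h' => (hAB ha h'.1).elim
  have hB : ∀ {a b}, G.Adj a b → b ∈ B → a ∈ A := fun hab hb =>
    (h.mem_of_adj hab).elim (·.1) fun h' => (hAB h'.2 hb).elim
  have hmem : ∀ v, v ∈ A ∨ v ∈ B := fun v =>
    (h.mem_of_adj (hiso v).choose_spec).imp (·.1) (·.1)
  have hB' : ∀ {v}, v ∉ A ↔ v ∈ B := fun {v} => ⟨(hmem v).resolve_left, fun hb ha => hAB ha hb⟩
  have hcross : ∀ {a a' b b'}, a ∈ A → a' ∈ A → G.Adj a b → G.Adj a' b' → G.Adj a b' ∨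
      G.Adj a' b := by
    intro a a' b b' ha ha' hab hab'
    by_contra! hne
    -- Bipartiteness excludes all other coincidences and adjacencies, so only the two crossing pairs
    -- matter.
    refine hG (twoDisjointEdges_isIndContained_iff.mpr
      ⟨a, b, a', b', hab, hab', ?_, ?_, ?_, ?_, ?_, hne.1, ?_, ?_⟩)
    · rintro rfl
      exact hne.1 hab'
    · rintro rfl
      exact hAB ha (hA hab' ha')
    · rintro rfl
      exact hAB ha' (hA hab ha)
    · rintro rfl
      exact hne.1 hab
    · exact fun h' => hAB ha' (hA h' ha)
    · exact fun h' => hne.2 h'.symm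
    · exact fun h' => hAB (hB h' (hA hab' ha')) (hA hab ha)
  -- neighbourhoods on one side form a chain, so they are ordered by their cardinalities
  have hchain : ∀ {u w}, (u ∈ A ↔ w ∈ A) →
      (G.neighborSet w).ncard ≤ (G.neighborSet u).ncard → G.neighborSet w ⊆ G.neighborSet u := by
    intro u w huw hcard
    by_contra hsub
    obtain ⟨b, hwb, hub⟩ := Set.not_subset.mp hsub
    refine absurd hcard (not_le.mpr (Set.ncard_lt_ncard ?_))
    refine Set.ssubset_iff_subset_ne.mpr ⟨fun c huc => ?_, fun heq => hub (heq ▸ hwb)⟩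
    rcases hmem u with hu | hu
    · exact (hcross hu (huw.mp hu) huc hwb).resolve_left hub
    · have hw : w ∈ B := hB'.mp fun hw => hAB (huw.mpr hw) hu
      have hwb' : G.Adj b w := SimpleGraph.Adj.symm hwb
      have huc' : G.Adj c u := SimpleGraph.Adj.symm huc
      exact ((hcross (hB hwb' hw) (hB huc' hu) hwb' huc').resolve_left
        fun h' => hub h'.symm).symm
  have hex : ∃ a ∈ A, ∃ b ∈ B, G.Adj a b := by
    obtain ⟨w, hw⟩ := hiso (Classical.arbitrary V)
    rcases h.mem_of_adj hw with ⟨h1, h2⟩ | ⟨h1, h2⟩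
    exacts [⟨_, h1, _, h2, hw⟩, ⟨_, h2, _, h1, hw.symm⟩]
  obtain ⟨a, ha, b, hb, -⟩ := hex
  have : Nonempty {v // v ∈ A} := ⟨⟨a, ha⟩⟩
  have : Nonempty {v // v ∉ A} := ⟨⟨b, hB'.mpr hb⟩⟩
  obtain ⟨n, e₁, he₁⟩ := exists_equiv_fin_antitone
    fun v : {v // v ∈ A} => (G.neighborSet v.1).ncard
  obtain ⟨m, e₂, he₂⟩ := exists_equiv_fin_antitone
    fun v : {v // v ∉ A} => (G.neighborSet v.1).ncard
  have h₁ : ∀ {i p b}, i ≤ p → G.Adj (e₁ p).1 b → G.Adj (e₁ i).1 b := fun {i p b} hip hpb =>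
    hchain (by simp [(e₁ i).2, (e₁ p).2]) (he₁ hip) hpb
  have h₂ : ∀ {j q a}, j ≤ q → G.Adj a (e₂ q).1 → G.Adj a (e₂ j).1 := fun {j q a} hjq hqa =>
    (hchain (by simp [(e₂ j).2, (e₂ q).2]) (he₂ hjq) hqa.symm : G.Adj (e₂ j).1 a).symm
  refine ⟨n, m, (Equiv.sumCongr e₁ e₂).trans (Equiv.sumCompl (· ∈ A)), ?_, ?_, ?_, ?_, ?_⟩
  · exact fun i j hij => hAB (e₁ j).2 (hA hij (e₁ i).2)
  · exact fun i j hij => (e₂ i).2 (hB hij (hB'.mp (e₂ j).2))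
  · exact fun p q hpq i hi j hj => h₁ hi (h₂ hj hpq)
  -- The last vertex on each side has some neighbour, and the Ferrers shape moves that neighbour to
  -- index 0.
  · obtain ⟨w, hw⟩ := hiso (e₂ (Fin.last m)).1
    have hwA : w ∈ A := hB hw.symm (hB'.mp (e₂ (Fin.last m)).2)
    obtain ⟨p, hp⟩ := e₁.surjective ⟨w, hwA⟩
    exact h₁ (Fin.zero_le p) (by rw [hp]; exact hw.symm)
  · obtain ⟨w, hw⟩ := hiso (e₁ (Fin.last n)).1
    have hwB : w ∉ A := hB'.mpr (hA hw (e₁ (Fin.last n)).2)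
    obtain ⟨q, hq⟩ := e₂.surjective ⟨w, hwB⟩
    exact h₂ (Fin.zero_le q) (by rw [hq]; exact hw)

end Combinatorics

/-! ### Linear syzygies and induced pairs of edges -/

section LinearSyzygies

variable {V K : Type*} [Field K] {G : SimpleGraph V}

lemma coeff_X_mul_X_of_mem_edgeIdeal {f : MvPolynomial V K} (hf : f ∈ edgeIdeal K G) {a b : V}
    (hab : ¬ G.Adj a b) : coeff (Finsupp.single a 1 + Finsupp.single b 1) f = 0 := by
  classical
  by_contra hne
  obtain ⟨x, y, hxy, hx, hy⟩ := exists_adj_of_mem_edgeIdeal hf hne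
  have haux : ∀ z, (Finsupp.single a 1 + Finsupp.single b 1 : V →₀ ℕ) z ≠ 0 → z = a ∨ z = b := by
    intro z hz
    by_contra! h
    exact hz (by simp [h.1.symm, h.2.symm])
  rcases haux x hx with rfl | rfl <;> rcases haux y hy with rfl | rfl
  · exact hxy.ne rfl
  · exact hab hxy
  · exact hab hxy.symm
  · exact hxy.ne rfl

/-- In a product with a linear form, a monomial is obtained by removing one of its variables. -/
lemma coeff_mul_of_isHomogeneous_one {l : MvPolynomial V K} (hl : l.IsHomogeneous 1)
    (f : MvPolynomial V K) {a b c : V} (hac : a ≠ c) (hbc : b ≠ c) (hab : a ≠ b) :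
    coeff (Finsupp.single a 1 + Finsupp.single b 1 + Finsupp.single c 1) (l * f) =
      coeff (Finsupp.single a 1) l * coeff (Finsupp.single b 1 + Finsupp.single c 1) f +
      coeff (Finsupp.single b 1) l * coeff (Finsupp.single a 1 + Finsupp.single c 1) f +
      coeff (Finsupp.single c 1) l * coeff (Finsupp.single a 1 + Finsupp.single b 1) f := by
  classical
  -- Both sides are linear in `l`, so it suffices to treat a single variable.
  have hl' : l ∈ Submodule.span K (Set.range (X : V → MvPolynomial V K)) := by
    rw [← homogeneousSubmodule_one_eq_span_X]
    exact hl
  clear hl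
  induction hl' using Submodule.span_induction with
  | mem x hx =>
    obtain ⟨v, rfl⟩ := hx
    have hX : ∀ w, coeff (Finsupp.single w 1) (X v : MvPolynomial V K) = if v = w then 1 else 0 :=
      fun w => by
        simp only [coeff_X, Finsupp.single_left_inj one_ne_zero]
    simp only [hX, coeff_X_mul']
    by_cases hva : v = a
    · subst hva
      have hm : Finsupp.single v 1 + Finsupp.single b 1 + Finsupp.single c 1 - Finsupp.single v 1 =
          (Finsupp.single b 1 + Finsupp.single c 1 : V →₀ ℕ) := by
        rw [add_assoc, add_tsub_cancel_left]
      simp [hm, hab, hac]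
    by_cases hvb : v = b
    · subst hvb
      have hm : Finsupp.single a 1 + Finsupp.single v 1 + Finsupp.single c 1 - Finsupp.single v 1 =
          (Finsupp.single a 1 + Finsupp.single c 1 : V →₀ ℕ) := by
        rw [add_right_comm, add_tsub_cancel_right]
      simp [hm, hab.symm, hbc]
    by_cases hvc : v = c
    · subst hvc
      simp [hac.symm, hbc.symm]
    · simp [hva, hvb, hvc]
  | zero => simp
  | add x y _ _ hx hy => rw [add_mul, coeff_add, hx, hy]; simp only [coeff_add]; ring
  | smul r x _ hx => rw [smul_mul_assoc, coeff_smul, hx]; simp only [coeff_smul, smul_eq_mul]; ring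

/-- Multiples of a homogeneous polynomial agree in its degree with scalar multiples. -/
lemma coeff_mul_of_degree_le {f : MvPolynomial V K} {t : ℕ} (hf : f.IsHomogeneous t)
    (u : MvPolynomial V K) {m : V →₀ ℕ} (hm : m.degree ≤ t) :
    coeff m (u * f) = constantCoeff u * coeff m f := by
  classical
  rw [coeff_mul, Finset.sum_eq_single (0, m), constantCoeff_eq]
  · rintro ⟨x, y⟩ hxy hne
    obtain rfl : x + y = m := by simpa using hxy
    have hx : x ≠ 0 := by
      rintro rfl
      simp at hne
    have hx' : x.degree ≠ 0 := by simpa [Finsupp.degree_eq_zero_iff] using hx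
    rw [map_add] at hm
    rw [hf.coeff_eq_zero (d := y) (by omega), mul_zero]
  · simp

/-- A linear form lies in the ideal generated by a set of variables if the other variables do
not occur in it. -/
lemma mem_span_X_of_isHomogeneous_one {l : MvPolynomial V K} (hl : l.IsHomogeneous 1) {s : Set V}
    (h : ∀ v ∉ s, coeff (Finsupp.single v 1) l = 0) :
    l ∈ Ideal.span (X '' s : Set (MvPolynomial V K)) := by
  rw [mem_ideal_span_X_image]
  intro m hm
  have hdeg : m.degree = 1 := by
    by_contra hne
    exact mem_support_iff.mp hm (hl.coeff_eq_zero hne)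
  obtain ⟨v, rfl⟩ := (Finsupp.sum_eq_one_iff _).mp hdeg
  refine ⟨v, ?_, by simp⟩
  by_contra hv
  exact mem_support_iff.mp hm (h v hv)

/-- If the edge ideal of a graph has a linear resolution, then the graph has no induced
pair of disjoint edges. -/
theorem HasLinearResolution.not_isIndContained (h : HasLinearResolution (edgeIdeal K G)) :
    ¬ SimpleGraph.IsIndContained twoDisjointEdges G := by
  classical
  rw [twoDisjointEdges_isIndContained_iff]
  rintro ⟨p, q, r, s, hpq, hrs, hpr, hps, hqr, hqs, npr, nps, nqr, nqs⟩
  obtain ⟨t, F, -, hdeg⟩ := h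
  let f : F.ι 0 → MvPolynomial V K := fun k => F.aug (Finsupp.single k 1)
  have hf : ∀ k, (f k).IsHomogeneous t := fun k => by
    have := F.aug_homogeneous k
    rwa [hdeg] at this
  have haug_mem : ∀ y, F.aug y ∈ edgeIdeal K G := fun y =>
    F.range_aug.le ⟨y, rfl⟩
  have haug : ∀ y : F.ι 0 →₀ MvPolynomial V K, F.aug y = ∑ k ∈ y.support, y k * f k := by
    intro y
    conv_lhs => rw [← Finsupp.sum_single y]
    rw [Finsupp.sum, map_sum]
    refine Finset.sum_congr rfl fun k _ => ?_
    rw [← smul_eq_mul, ← map_smul, Finsupp.smul_single, smul_eq_mul, mul_one]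
  have hedge : ∀ {a b}, G.Adj a b → ∃ u, F.aug u = X a * X b := by
    intro a b hab
    have hmem : (X a * X b : MvPolynomial V K) ∈ edgeIdeal K G :=
      Ideal.subset_span ⟨a, b, hab, rfl⟩
    rwa [← F.range_aug] at hmem
  obtain ⟨u, hu⟩ := hedge hpq
  obtain ⟨w, hw⟩ := hedge hrs
  -- Some generator is nonzero, and each of its monomials is divisible by an edge.
  have ht : 2 ≤ t := by
    obtain ⟨k, hk⟩ : ∃ k, f k ≠ 0 := by
      by_contra! h0
      have : F.aug u = 0 := by rw [haug]; simp [h0]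
      rw [hu] at this
      simp at this
    obtain ⟨m, hm⟩ := ne_zero_iff.mp hk
    obtain ⟨a, b, hab, ha, hb⟩ := exists_adj_of_mem_edgeIdeal (haug_mem _) hm
    have hmt : m.degree = t := by
      by_contra hne
      exact hm ((hf k).coeff_eq_zero hne)
    rw [← hmt, Finsupp.degree]
    calc 2 ≤ m a + m b := by omega
      _ = ∑ v ∈ {a, b}, m v := (Finset.sum_pair hab.ne).symm
      _ ≤ ∑ v ∈ m.support, m v :=
        Finset.sum_le_sum_of_subset (by simp [Finset.insert_subset_iff, ha, hb])
  let c : F.ι 0 → K := fun k => coeff (Finsupp.single p 1 + Finsupp.single q 1) (f k)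
  let L : (F.ι 0 →₀ MvPolynomial V K) →ₗ[MvPolynomial V K] MvPolynomial V K :=
    Finsupp.linearCombination _ fun k => C (c k)
  have hL : ∀ (y : F.ι 0 →₀ MvPolynomial V K) m,
      coeff m (L y) = ∑ k ∈ y.support, coeff m (y k) * c k := by
    intro y m
    simp [L, Finsupp.linearCombination_apply, Finsupp.sum, coeff_sum, mul_comm _ (C _),
      coeff_C_mul, mul_comm (c _)]
  let Q : Ideal (MvPolynomial V K) := Ideal.span (X '' {v | v ≠ r ∧ v ≠ s})
  have hcoeff : ∀ {y : F.ι 0 →₀ MvPolynomial V K}, (∀ k, (y k).IsHomogeneous 1) → F.aug y = 0 →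
      ∀ {v}, v ≠ p → v ≠ q → ¬ G.Adj p v → ¬ G.Adj q v → coeff (Finsupp.single v 1) (L y) = 0 := by
    intro y hy hy0 v hvp hvq npv nqv
    have h0 := congrArg
      (coeff (Finsupp.single p 1 + Finsupp.single q 1 + Finsupp.single v 1)) hy0
    rw [haug, coeff_sum, coeff_zero] at h0
    rw [hL, ← h0]
    refine Finset.sum_congr rfl fun k _ => ?_
    -- The coefficient of x_p x_q x_v splits into three terms; two vanish because pv and qv are not
    -- edges, and the third is the contribution to `L y`.
    rw [coeff_mul_of_isHomogeneous_one (hy k) _ hvp.symm hvq.symm hpq.ne,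
      coeff_X_mul_X_of_mem_edgeIdeal (haug_mem _) npv,
      coeff_X_mul_X_of_mem_edgeIdeal (haug_mem _) nqv]
    ring
  have hd : ∀ j, L (F.d 0 (Finsupp.single j 1)) ∈ Q := by
    intro j
    have hlin : ∀ k, (F.d 0 (Finsupp.single j 1) k).IsHomogeneous 1 := by
      intro k
      rcases F.d_homogeneous 0 j k with h0 | ⟨n, hn, hhom⟩
      · rw [h0]
        exact isHomogeneous_zero _ _ _
      · rw [hdeg, hdeg] at hn
        obtain rfl : n = 1 := by omega
        exact hhom
    have hzero : F.aug (F.d 0 (Finsupp.single j 1)) = 0 := F.exact_zero.apply_apply_eq_zero _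
    refine mem_span_X_of_isHomogeneous_one ?_ fun v hv => ?_
    · simp only [L, Finsupp.linearCombination_apply, Finsupp.sum]
      exact IsHomogeneous.sum _ _ _ fun k _ => (hlin k).mul (isHomogeneous_C V (c k))
    · have hv' : v = r ∨ v = s := by
        by_contra! hne
        exact hv hne
      rcases hv' with rfl | rfl
      · exact hcoeff hlin hzero hpr.symm hqr.symm npr nqr
      · exact hcoeff hlin hzero hps.symm hqs.symm nps nqs
  have hker : ∀ y, F.aug y = 0 → L y ∈ Q := by
    intro y hy
    obtain ⟨z, rfl⟩ := (F.exact_zero y).mp hy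
    induction z using Finsupp.induction_linear with
    | zero => simp
    | add z₁ z₂ h₁ h₂ =>
      rw [map_add, map_add]
      exact add_mem (h₁ (F.exact_zero.apply_apply_eq_zero _))
        (h₂ (F.exact_zero.apply_apply_eq_zero _))
    | single j a =>
      rw [← mul_one a, ← smul_eq_mul, ← Finsupp.smul_single, map_smul, map_smul]
      exact Submodule.smul_mem _ _ (hd j)
  -- This is the Koszul relation between x_p x_q and x_r x_s, lifted along `F.aug`.
  have hK := hker ((X r * X s : MvPolynomial V K) • u - (X p * X q : MvPolynomial V K) • w) (by
    rw [map_sub, map_smul, map_smul, hu, hw, smul_eq_mul, smul_eq_mul, mul_comm, sub_self])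
  rw [map_sub, map_smul, map_smul, smul_eq_mul, smul_eq_mul] at hK
  have hp : (X p * X q * L w : MvPolynomial V K) ∈ Q :=
    Ideal.mul_mem_right _ _ (Ideal.mul_mem_right _ _
      (Ideal.subset_span ⟨p, ⟨hpr, hps⟩, rfl⟩))
  have hLu : L u * X s * X r ∈ Q := by
    convert add_mem hK hp using 1
    ring
  have hLu' : L u ∈ Q := mem_span_X_of_mul_X_mem (a := s) (by simp)
    (mem_span_X_of_mul_X_mem (a := r) (by simp) hLu)
  -- Since the generators have degree `t ≥ 2`, only constant terms of the entries of `u` contribute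
  -- to the coefficient of x_p x_q in `F.aug u`.
  have hone : coeff 0 (L u) = 1 := by
    have h1 := congrArg (coeff (Finsupp.single p 1 + Finsupp.single q 1)) hu
    have hX : coeff (Finsupp.single p 1 + Finsupp.single q 1) (X p * X q : MvPolynomial V K) = 1 := by
      rw [coeff_mul_X]
      simp
    rw [haug, coeff_sum, hX] at h1
    rw [hL, ← h1]
    refine Finset.sum_congr rfl fun k _ => ?_
    rw [coeff_mul_of_degree_le (hf k) _ (by simpa using ht), constantCoeff_eq]
  obtain ⟨v, -, hv⟩ := mem_ideal_span_X_image.mp hLu' 0 (by simp [hone])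
  exact hv rfl

end LinearSyzygies

end FlagIdeals

theorem mainTheorem6 {V : Type*} [Finite V] [Nonempty V] (K : Type*) [Field K]
    (G : SimpleGraph V) (A B : Set V) (hG : G.IsBipartiteWith A B)
    (hiso : ∀ v, ∃ w, G.Adj v w) :
    List.TFAE [
      FlagIdeals.HasLinearResolution (FlagIdeals.bipartiteFlagIdeal K hG),
      ¬ SimpleGraph.IsIndContained FlagIdeals.twoDisjointEdges G,
      FlagIdeals.IsFerrersGraph G] := by
  rw [FlagIdeals.bipartiteFlagIdeal_eq_edgeIdeal K hG hiso]
  tfae_have 1 → 2 := fun h => h.not_isIndContained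
  tfae_have 2 → 3 := FlagIdeals.IsFerrersGraph.of_not_isIndContained hG hiso
  tfae_have 3 → 1 := fun h => h.hasLinearResolution K
  tfae_finish
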